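/- Let $L^2(0,1)$ be the real Hilbert space of square integrable functions on $(0,1)$ and $\ell^2$ the real Hilbert space of square summable sequences. Let $J : L^2(0,1) \to L^2(0,1)$ be the integration operator $[Jx](s) = \int_0^s x(t)\,dt$, and let $B^{(H)} : L^2(0,1) \to \ell^2$ be the Hausdorff moment operator $[B^{(H)}z]_j = \int_0^1 t^{j-1} z(t)\,dt$, $j = 1, 2, \dots$; both are bounded linear operators. For a compact operator $T$ between real Hilbert spaces and $i = 1, 2, \dots$ let $\sigma_i(T)$ denote its $i$-th singular value, i.e. the square root of the $i$-th largest eigenvalue of $T^*T$, counted with multiplicity. Theorem 5.1. The operators $J$ and $B^{(H)} \circ J$ are compact, while $B^{(H)}$ is not compact. There is a constant $C > 0$ such that $$\sigma_i(B^{(H)} \circ J) \le \frac{C}{i^{3/2}} \qquad (i = 1, 2, \dots).$$ Moreover, $\sigma_i(J) \asymp 1/i$, i.e. there are constants $c_1, c_2 > 0$ with $c_1/i \le \sigma_i(J) \le c_2/i$ for all $i = 1, 2, \dots$, and consequently there is a constant $K > 0$ such that $$\frac{\sigma_i(B^{(H)} \circ J)}{\sigma_i(J)} \le \frac{K}{i^{1/2}}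 \qquad (i = 1, 2, \dots).$$ Thus composition with the non-compact outer factor $B^{(H)}$ makes the singular values decay faster than those of the compact inner factor $J$. -/

import Mathlib

open MeasureTheory

noncomputable section

namespace HausdorffMoment

/-- Lebesgue measure on the open unit interval. -/
abbrev unitVol : Measure ℝ := volume.restrict (Set.Ioo (0 : ℝ) 1)

instance : IsProbabilityMeasure unitVol :=
  ⟨by simp⟩

/-- The real Hilbert space `L²(0,1)`. -/
abbrev L2 : Type := Lp ℝ 2 unitVol

/-- The real Hilbert space `ℓ²` of square summable sequences (indexed from `0`). -/
abbrev ell2 : Type := lp (fun _ : ℕ => ℝ) 2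

/-! ### The integration operator -/

theorem integrableOn_Icc (x : L2) : IntegrableOn (fun t => x t) (Set.Icc (0 : ℝ) 1) volume := by
  rw [integrableOn_Icc_iff_integrableOn_Ioo]
  exact (Lp.memLp x).integrable (by norm_num)

theorem intervalIntegrable_of_mem (x : L2) {s : ℝ} (hs : s ∈ Set.Ioo (0 : ℝ) 1) :
    IntervalIntegrable (fun t => x t) volume 0 s := by
  rw [intervalIntegrable_iff_integrableOn_Ioc_of_le hs.1.le]
  exact (integrableOn_Icc x).mono_set
    (Set.Ioc_subset_Icc_self.trans (Set.Icc_subset_Icc le_rfl hs.2.le))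

theorem integral_abs_le (x : L2) : ∫ t, |x t| ∂unitVol ≤ ‖x‖ := by
  have h1 : eLpNorm x 1 unitVol ≤ eLpNorm x 2 unitVol :=
    eLpNorm_le_eLpNorm_of_exponent_le (by norm_num) (Lp.aestronglyMeasurable x)
  have h2 := integral_norm_eq_lintegral_enorm (μ := unitVol) (Lp.aestronglyMeasurable x)
  simp only [Real.norm_eq_abs] at h2
  rw [h2, Lp.norm_def, ← eLpNorm_one_eq_lintegral_enorm]
  exact ENNReal.toReal_mono (Lp.eLpNorm_ne_top x) h1

theorem abs_primitive_le (x : L2) {s : ℝ} (hs : s ∈ Set.Ioo (0 : ℝ) 1) :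
    |∫ t in (0 : ℝ)..s, x t| ≤ ‖x‖ := by
  have hi : Integrable (fun t => |x t|) unitVol :=
    ((Lp.memLp x).integrable (by norm_num)).abs
  calc |∫ t in (0 : ℝ)..s, x t| ≤ ∫ t in (0 : ℝ)..s, |x t| :=
        intervalIntegral.abs_integral_le_integral_abs hs.1.le
    _ = ∫ t in Set.Ioc 0 s, |x t| := intervalIntegral.integral_of_le hs.1.le
    _ ≤ ∫ t in Set.Ioo (0 : ℝ) 1, |x t| := by
        refine setIntegral_mono_set hi (Filter.Eventually.of_forall fun _ => abs_nonneg _) ?_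
        exact Filter.Eventually.of_forall fun t ht => ⟨ht.1, ht.2.trans_lt hs.2⟩
    _ ≤ ‖x‖ := integral_abs_le x

theorem aestronglyMeasurable_primitive (x : L2) :
    AEStronglyMeasurable (fun s : ℝ => ∫ t in (0 : ℝ)..s, x t) unitVol := by
  have h : ContinuousOn (fun s : ℝ => ∫ t in (0 : ℝ)..s, x t) (Set.uIcc 0 1) :=
    intervalIntegral.continuousOn_primitive_interval
      (by rw [Set.uIcc_of_le zero_le_one]; exact integrableOn_Icc x)
  refine (h.mono ?_).aestronglyMeasurable measurableSet_Ioo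
  rw [Set.uIcc_of_le zero_le_one]
  exact Set.Ioo_subset_Icc_self

theorem ae_bound_primitive (x : L2) :
    ∀ᵐ s ∂unitVol, ‖∫ t in (0 : ℝ)..s, x t‖ ≤ ‖x‖ :=
  (ae_restrict_iff' measurableSet_Ioo).2 (Filter.Eventually.of_forall fun _ hs =>
    abs_primitive_le x hs)

theorem memLp_primitive (x : L2) :
    MemLp (fun s : ℝ => ∫ t in (0 : ℝ)..s, x t) 2 unitVol :=
  MemLp.of_bound (aestronglyMeasurable_primitive x) ‖x‖ (ae_bound_primitive x)

/-- The integration operator `[J x](s) = ∫₀ˢ x(t) dt` as a bounded operator on `L²(0,1)`. -/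
def J : L2 →L[ℝ] L2 :=
  LinearMap.mkContinuous
    { toFun := fun x => (memLp_primitive x).toLp (fun s : ℝ => ∫ t in (0 : ℝ)..s, x t)
      map_add' := by
        intro x y
        rw [← MemLp.toLp_add]
        refine MemLp.toLp_congr _ _ ?_
        refine (ae_restrict_iff' measurableSet_Ioo).2 (Filter.Eventually.of_forall fun s hs => ?_)
        have hxy := (ae_restrict_iff' measurableSet_Ioo).1 (Lp.coeFn_add x y)
        have : ∫ t in (0 : ℝ)..s, (x + y) t = ∫ t in (0 : ℝ)..s, (x t + y t) := by
          refine intervalIntegral.integral_congr_ae ?_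
          filter_upwards [hxy] with t ht hts
          rw [Set.uIoc_of_le hs.1.le] at hts
          simpa using ht ⟨hts.1, hts.2.trans_lt hs.2⟩
        simp only [Pi.add_apply]
        rw [this, intervalIntegral.integral_add (intervalIntegrable_of_mem x hs)
          (intervalIntegrable_of_mem y hs)]
      map_smul' := by
        intro c x
        rw [RingHom.id_apply, ← MemLp.toLp_const_smul]
        refine MemLp.toLp_congr _ _ ?_
        refine (ae_restrict_iff' measurableSet_Ioo).2 (Filter.Eventually.of_forall fun s hs => ?_)
        have hxy := (ae_restrict_iff' measurableSet_Ioo).1 (Lp.coeFn_smul c x)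
        have : ∫ t in (0 : ℝ)..s, (c • x) t = ∫ t in (0 : ℝ)..s, c • x t := by
          refine intervalIntegral.integral_congr_ae ?_
          filter_upwards [hxy] with t ht hts
          rw [Set.uIoc_of_le hs.1.le] at hts
          simpa using ht ⟨hts.1, hts.2.trans_lt hs.2⟩
        simp only [Pi.smul_apply]
        rw [this, intervalIntegral.integral_smul] }
    1 (by
      intro x
      have h := Lp.norm_le_of_ae_bound (p := 2) (μ := unitVol)
        (f := (memLp_primitive x).toLp (fun s : ℝ => ∫ t in (0 : ℝ)..s, x t))
        (norm_nonneg x) (by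
          filter_upwards [(memLp_primitive x).coeFn_toLp, ae_bound_primitive x] with s h1 h2
          rw [h1]; exact h2)
      simpa [measureUnivNNReal, Measure.restrict_apply] using h)

theorem J_apply_ae (x : L2) :
    ∀ᵐ s ∂unitVol, J x s = ∫ t in (0 : ℝ)..s, x t :=
  (memLp_primitive x).coeFn_toLp

/-! ### The Hausdorff moment operator -/

theorem memLp_pow (j : ℕ) : MemLp (fun t : ℝ => t ^ j) 2 unitVol := by
  refine MemLp.of_bound (by fun_prop) 1 ?_
  refine (ae_restrict_iff' measurableSet_Ioo).2 (Filter.Eventually.of_forall fun t ht => ?_)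
  rw [Real.norm_eq_abs, abs_pow, abs_of_pos ht.1]
  exact pow_le_one₀ ht.1.le ht.2.le

/-- The monomial `t ^ j` as an element of `L²(0,1)`. -/
def mono (j : ℕ) : L2 := (memLp_pow j).toLp (fun t : ℝ => t ^ j)

/-- The moment `∫₀¹ t ^ j z(t) dt`. -/
def moment (z : L2) (j : ℕ) : ℝ := ∫ t in Set.Ioo (0 : ℝ) 1, t ^ j * z t

theorem moment_eq_inner (z : L2) (j : ℕ) : moment z j = inner ℝ (mono j) z := by
  rw [L2.inner_def, moment]
  refine integral_congr_ae ?_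
  filter_upwards [(memLp_pow j).coeFn_toLp] with t ht
  simp [mono, ht, mul_comm]

theorem inner_mono (i j : ℕ) : inner ℝ (mono i) (mono j) = 1 / ((i : ℝ) + j + 1) := by
  rw [← moment_eq_inner, moment]
  have h : ∫ t in Set.Ioo (0 : ℝ) 1, t ^ i * mono j t = ∫ t in Set.Ioo (0 : ℝ) 1, t ^ (i + j) := by
    refine integral_congr_ae ?_
    filter_upwards [(memLp_pow j).coeFn_toLp] with t ht
    simp only [mono, ht, pow_add]
  rw [h, ← integral_Ioc_eq_integral_Ioo, ← intervalIntegral.integral_of_le zero_le_one,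
    integral_pow]
  simp

theorem hilbert_term_le (i j : ℕ) :
    1 / ((i : ℝ) + j + 1) * (1 / √((j : ℝ) + 1)) ≤
      8 / √((i : ℝ) + 1) * (√((j : ℝ) + 1) / (√((j : ℝ) + 1) + √((i : ℝ) + 1))
        - √(j : ℝ) / (√(j : ℝ) + √((i : ℝ) + 1))) := by
  have hb : 0 < √((i : ℝ) + 1) := Real.sqrt_pos.2 (by positivity)
  have hy : 0 < √((j : ℝ) + 1) := Real.sqrt_pos.2 (by positivity)
  have hx : 0 ≤ √(j : ℝ) := Real.sqrt_nonneg _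
  have hb2 : √((i : ℝ) + 1) ^ 2 = i + 1 := Real.sq_sqrt (by positivity)
  have hy2 : √((j : ℝ) + 1) ^ 2 = j + 1 := Real.sq_sqrt (by positivity)
  have hx2 : √(j : ℝ) ^ 2 = j := Real.sq_sqrt (by positivity)
  have hxy : √(j : ℝ) ≤ √((j : ℝ) + 1) := Real.sqrt_le_sqrt (by linarith)
  have hi : (0 : ℝ) ≤ i := Nat.cast_nonneg i
  have hj : (0 : ℝ) ≤ j := Nat.cast_nonneg j
  set b := √((i : ℝ) + 1)
  set y := √((j : ℝ) + 1)
  set x := √(j : ℝ)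
  have e : 8 / b * (y / (y + b) - x / (x + b)) = 8 * (y - x) / ((y + b) * (x + b)) := by
    field_simp
    ring
  have hd : 1 ≤ 2 * y * (y - x) := by nlinarith
  have hq : (y + b) * (x + b) ≤ 4 * ((i : ℝ) + j + 1) := by
    nlinarith [sq_nonneg (y - b)]
  rw [e, div_mul_div_comm, one_mul, div_le_div_iff₀ (by positivity) (by positivity)]
  have hyx : 0 ≤ y - x := by linarith
  calc 1 * ((y + b) * (x + b)) ≤ 4 * ((i : ℝ) + j + 1) := by linarith
    _ ≤ 4 * ((i : ℝ) + j + 1) * (2 * y * (y - x)) :=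
        le_mul_of_one_le_right (by positivity) hd
    _ = 8 * (y - x) * (((i : ℝ) + j + 1) * y) := by ring

theorem hilbert_row_le (i N : ℕ) :
    ∑ j ∈ Finset.range N, 1 / ((i : ℝ) + j + 1) * (1 / √((j : ℝ) + 1)) ≤
      8 / √((i : ℝ) + 1) := by
  have hb : 0 < √((i : ℝ) + 1) := Real.sqrt_pos.2 (by positivity)
  have h := Finset.sum_range_sub
    (fun j : ℕ => 8 / √((i : ℝ) + 1) * (√(j : ℝ) / (√(j : ℝ) + √((i : ℝ) + 1)))) N
  have h2 : ∑ j ∈ Finset.range N, 1 / ((i : ℝ) + j + 1) * (1 / √((j : ℝ) + 1)) ≤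
      8 / √((i : ℝ) + 1) * (√(N : ℝ) / (√(N : ℝ) + √((i : ℝ) + 1))) := by
    simp only [Nat.cast_zero, Real.sqrt_zero, zero_div, mul_zero, sub_zero] at h
    rw [← h]
    refine Finset.sum_le_sum fun j _ => (hilbert_term_le i j).trans_eq ?_
    push_cast
    ring
  refine h2.trans (mul_le_of_le_one_right (by positivity) ?_)
  rw [div_le_one (by positivity)]
  linarith

/-- Boundedness of the quadratic form of the Hilbert matrix. -/
theorem hilbert_form_le (a : ℕ → ℝ) (N : ℕ) :
    ∑ i ∈ Finset.range N, ∑ j ∈ Finset.range N, a i * a j * (1 / ((i : ℝ) + j + 1)) ≤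
      8 * ∑ i ∈ Finset.range N, a i ^ 2 := by
  have hw : ∀ i : ℕ, 0 < √((i : ℝ) + 1) := fun i => Real.sqrt_pos.2 (by positivity)
  have hrow : ∑ i ∈ Finset.range N, ∑ j ∈ Finset.range N,
      a i ^ 2 * √((i : ℝ) + 1) * (1 / ((i : ℝ) + j + 1) * (1 / √((j : ℝ) + 1))) ≤
      8 * ∑ i ∈ Finset.range N, a i ^ 2 := by
    rw [Finset.mul_sum]
    refine Finset.sum_le_sum fun i _ => ?_
    rw [← Finset.mul_sum]
    have hi := hw i
    calc _ ≤ a i ^ 2 * √((i : ℝ) + 1) * (8 / √((i : ℝ) + 1)) :=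
          mul_le_mul_of_nonneg_left (hilbert_row_le i N) (by positivity)
      _ = 8 * a i ^ 2 := by field_simp
  have hsymm : ∑ i ∈ Finset.range N, ∑ j ∈ Finset.range N,
      a j ^ 2 * √((j : ℝ) + 1) * (1 / ((j : ℝ) + i + 1) * (1 / √((i : ℝ) + 1))) =
      ∑ i ∈ Finset.range N, ∑ j ∈ Finset.range N,
      a i ^ 2 * √((i : ℝ) + 1) * (1 / ((i : ℝ) + j + 1) * (1 / √((j : ℝ) + 1))) :=
    Finset.sum_comm
  have hterm : ∑ i ∈ Finset.range N, ∑ j ∈ Finset.range N,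
        a i * a j * (1 / ((i : ℝ) + j + 1)) ≤
      ∑ i ∈ Finset.range N, ∑ j ∈ Finset.range N,
        (1 / 2 * (a i ^ 2 * √((i : ℝ) + 1) * (1 / ((i : ℝ) + j + 1) * (1 / √((j : ℝ) + 1))))
        + 1 / 2 *
          (a j ^ 2 * √((j : ℝ) + 1) * (1 / ((j : ℝ) + i + 1) * (1 / √((i : ℝ) + 1))))) := by
    refine Finset.sum_le_sum fun i _ => Finset.sum_le_sum fun j _ => ?_
    have hi := hw i
    have hj := hw j
    rw [add_comm (j : ℝ) i]
    have hk : (0 : ℝ) < 1 / ((i : ℝ) + j + 1) := by positivity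
    set k := 1 / ((i : ℝ) + j + 1)
    set p := √((i : ℝ) + 1)
    set q := √((j : ℝ) + 1)
    have e : 1 / 2 * (a i ^ 2 * p * (k * (1 / q))) + 1 / 2 * (a j ^ 2 * q * (k * (1 / p)))
        - a i * a j * k = k * (a i * p - a j * q) ^ 2 / (2 * p * q) := by
      field_simp
      ring
    have : 0 ≤ k * (a i * p - a j * q) ^ 2 / (2 * p * q) := by positivity
    linarith
  refine hterm.trans ?_
  have hsplit : ∀ f g : ℕ → ℕ → ℝ, ∑ i ∈ Finset.range N, ∑ j ∈ Finset.range N,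
      (1 / 2 * f i j + 1 / 2 * g i j) =
      1 / 2 * ∑ i ∈ Finset.range N, ∑ j ∈ Finset.range N, f i j +
      1 / 2 * ∑ i ∈ Finset.range N, ∑ j ∈ Finset.range N, g i j := by
    intro f g
    simp only [Finset.sum_add_distrib, ← Finset.mul_sum]
  rw [hsplit, hsymm]
  linarith

theorem sum_range_moment_sq_le (z : L2) (N : ℕ) :
    ∑ j ∈ Finset.range N, moment z j ^ 2 ≤ 8 * ‖z‖ ^ 2 := by
  set S := ∑ j ∈ Finset.range N, moment z j ^ 2 with hS
  set p : L2 := ∑ j ∈ Finset.range N, moment z j • mono j with hp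
  have hS0 : 0 ≤ S := Finset.sum_nonneg fun _ _ => sq_nonneg _
  have h1 : S = inner ℝ p z := by
    rw [hp, sum_inner, hS]
    refine Finset.sum_congr rfl fun j _ => ?_
    rw [real_inner_smul_left, ← moment_eq_inner, sq]
  have h2 : ‖p‖ ^ 2 ≤ 8 * S := by
    rw [← real_inner_self_eq_norm_sq]
    refine le_of_eq_of_le ?_ (hilbert_form_le (moment z) N)
    rw [hp, sum_inner]
    refine Finset.sum_congr rfl fun i _ => ?_
    rw [inner_sum]
    refine Finset.sum_congr rfl fun j _ => ?_
    rw [real_inner_smul_left, real_inner_smul_right, inner_mono]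
    ring
  have h3 : S ≤ ‖p‖ * ‖z‖ := h1 ▸ real_inner_le_norm p z
  by_contra! hlt
  have hSpos : 0 < S := lt_of_le_of_lt (by positivity) hlt
  have h4 : S ^ 2 ≤ (‖p‖ * ‖z‖) ^ 2 := pow_le_pow_left₀ hS0 h3 2
  have h5 : (‖p‖ * ‖z‖) ^ 2 ≤ 8 * S * ‖z‖ ^ 2 := by
    rw [mul_pow]
    exact mul_le_mul_of_nonneg_right h2 (sq_nonneg _)
  nlinarith

theorem sum_moment_sq_le (z : L2) (s : Finset ℕ) :
    ∑ j ∈ s, ‖moment z j‖ ^ (2 : ENNReal).toReal ≤ (3 * ‖z‖) ^ (2 : ENNReal).toReal := by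
  obtain ⟨N, hN⟩ := s.exists_nat_subset_range
  simp only [ENNReal.toReal_ofNat, Real.rpow_ofNat, Real.norm_eq_abs, sq_abs]
  have h1 := sum_range_moment_sq_le z N
  have h2 : ∑ j ∈ s, moment z j ^ 2 ≤ ∑ j ∈ Finset.range N, moment z j ^ 2 :=
    Finset.sum_le_sum_of_subset_of_nonneg hN fun _ _ _ => sq_nonneg _
  nlinarith [sq_nonneg ‖z‖]

theorem memlp_moment (z : L2) : Memℓp (E := fun _ : ℕ => ℝ) (fun j => moment z j) 2 :=
  memℓp_gen' (sum_moment_sq_le z)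

/-- The Hausdorff moment operator `B : L²(0,1) → ℓ²`, whose `j`-th component (`j = 0, 1, 2, …`)
is `∫₀¹ t ^ j z(t) dt`. -/
def B : L2 →L[ℝ] ell2 :=
  LinearMap.mkContinuous
    { toFun := fun z => ⟨fun j => moment z j, memlp_moment z⟩
      map_add' := by
        intro x y
        ext j
        change moment (x + y) j = moment x j + moment y j
        simp only [moment_eq_inner, inner_add_right]
      map_smul' := by
        intro c x
        ext j
        change moment (c • x) j = c * moment x j
        simp only [moment_eq_inner, real_inner_smul_right] }
    3 (by
      intro z
      exact lp.norm_le_of_forall_sum_le (by norm_num) (by positivity) (sum_moment_sq_le z))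

theorem B_apply (z : L2) (j : ℕ) : B z j = ∫ t in Set.Ioo (0 : ℝ) 1, t ^ j * z t := rfl

/-! ### Singular values -/

section SingularValues

variable {E F : Type*} [NormedAddCommGroup E] [InnerProductSpace ℝ E] [CompleteSpace E]
  [NormedAddCommGroup F] [InnerProductSpace ℝ F] [CompleteSpace F]

/-- The (linear) span of all eigenvectors of `T* T` with eigenvalue at least `r`. Its dimension is
the number of eigenvalues of `T* T` that are at least `r`, counted with multiplicity. -/
def eigenspaceGE (T : E →L[ℝ] F) (r : ℝ) : Submodule ℝ E :=
  ⨆ ν : Set.Ici r, Module.End.eigenspace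
    ((ContinuousLinearMap.adjoint T ∘L T : E →L[ℝ] E) : E →ₗ[ℝ] E) (ν : ℝ)

/-- The `i`-th singular value (`i = 1, 2, …`) of a compact operator `T`: the square root of the
`i`-th largest eigenvalue of `T* T`, counted with multiplicity. In other words, it is the largest
`s ≥ 0` such that `T* T` has at least `i` eigenvalues, counted with multiplicity, that are at least
`s ^ 2`. (It is used for compact `T` and `i ≥ 1` only.) -/
def singularValue (T : E →L[ℝ] F) (i : ℕ) : ℝ :=
  sSup {s : ℝ | 0 ≤ s ∧ (i : Cardinal) ≤ Module.rank ℝ (eigenspaceGE T (s ^ 2))}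

/-- The singular values agree with the numbers `σ` in any (monotonic) singular system
`(σ, u, v)` of `T` (here indexed from `0`), that is, in any expansion
`T x = ∑ₖ σₖ ⟪uₖ, x⟫ vₖ` with orthonormal `u`, `v` and nonincreasing `σₖ ≥ 0`. -/
theorem singularValue_eq_of_singularSystem (T : E →L[ℝ] F) (σ : ℕ → ℝ) (u : ℕ → E) (v : ℕ → F)
    (hσ : Antitone σ) (hσ0 : ∀ k, 0 ≤ σ k) (hu : Orthonormal ℝ u) (hv : Orthonormal ℝ v)
    (hT : ∀ x, HasSum (fun k => (σ k * inner ℝ (u k) x) • v k) (T x)) (i : ℕ) :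
    singularValue T (i + 1) = σ i := by
  classical
  have hinn : ∀ x k, inner ℝ (v k) (T x) = σ k * inner ℝ (u k) x := by
    intro x k
    have h := (hT x).mapL (innerSL ℝ (v k))
    refine h.unique ?_
    have h2 : HasSum (fun j => innerSL ℝ (v k) ((σ j * inner ℝ (u j) x) • v j))
        (innerSL ℝ (v k) ((σ k * inner ℝ (u k) x) • v k)) := by
      refine hasSum_single k fun j hj => ?_
      simp [hv.2 hj.symm]
    simpa [real_inner_smul_right, hv.1 k] using h2
  have hadj : ∀ k, ContinuousLinearMap.adjoint T (v k) = σ k • u k := by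
    intro k
    refine ext_inner_right ℝ fun y => ?_
    rw [ContinuousLinearMap.adjoint_inner_left, hinn, real_inner_smul_left]
  have hTu : ∀ k, T (u k) = σ k • v k := by
    intro k
    refine (hT (u k)).unique ?_
    have h2 := hasSum_single (f := fun j => (σ j * inner ℝ (u j) (u k)) • v j) k
      fun j hj => by simp [hu.2 hj]
    simpa [hu.1 k] using h2
  have hmem : ∀ k, k ≤ i → u k ∈ eigenspaceGE T (σ i ^ 2) := by
    intro k hk
    have hle : σ i ^ 2 ≤ σ k ^ 2 := pow_le_pow_left₀ (hσ0 i) (hσ hk) 2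
    refine Submodule.mem_iSup_of_mem (⟨σ k ^ 2, hle⟩ : Set.Ici (σ i ^ 2)) ?_
    rw [Module.End.mem_eigenspace_iff]
    simp [hTu, hadj, smul_smul, sq]
  refine IsGreatest.csSup_eq ⟨⟨hσ0 i, ?_⟩, ?_⟩
  · let w : Fin (i + 1) → eigenspaceGE T (σ i ^ 2) :=
      fun k => ⟨u k, hmem k (Nat.lt_succ_iff.1 k.2)⟩
    have hw : LinearIndependent ℝ w := by
      refine LinearIndependent.of_comp (eigenspaceGE T (σ i ^ 2)).subtype ?_
      exact hu.linearIndependent.comp (fun k : Fin (i + 1) => (k : ℕ)) Fin.val_injective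
    simpa using hw.cardinal_lift_le_rank
  · rintro s ⟨hs0, hs⟩
    by_contra! hlt
    have hsub : eigenspaceGE T (s ^ 2) ≤
        Submodule.span ℝ (((Finset.range i).image u : Finset E) : Set E) := by
      refine iSup_le ?_
      rintro ⟨ν, hν⟩ x hx
      have hν' : σ i ^ 2 < ν := lt_of_lt_of_le (pow_lt_pow_left₀ hlt (hσ0 i) two_ne_zero) hν
      have hνpos : 0 < ν := lt_of_le_of_lt (sq_nonneg _) hν'
      rw [Module.End.mem_eigenspace_iff] at hx
      replace hx : ContinuousLinearMap.adjoint T (T x) = ν • x := hx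
      have hzero : ∀ k, i ≤ k → inner ℝ (u k) x = 0 := by
        intro k hk
        have h1 : inner ℝ (u k) (ContinuousLinearMap.adjoint T (T x)) =
            σ k * (σ k * inner ℝ (u k) x) := by
          rw [ContinuousLinearMap.adjoint_inner_right, hTu, real_inner_smul_left, hinn]
        rw [hx, real_inner_smul_right] at h1
        have h2 : σ k ^ 2 ≤ σ i ^ 2 := pow_le_pow_left₀ (hσ0 k) (hσ hk) 2
        have h3 : (ν - σ k ^ 2) * inner ℝ (u k) x = 0 := by linear_combination h1
        rcases mul_eq_zero.1 h3 with h | h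
        · linarith
        · exact h
      have hfin : T x = ∑ k ∈ Finset.range i, (σ k * inner ℝ (u k) x) • v k := by
        refine (hT x).unique (hasSum_sum_of_ne_finset_zero fun k hk => ?_)
        rw [hzero k (by simpa using hk)]
        simp
      have hx2 : x = ν⁻¹ • ContinuousLinearMap.adjoint T (T x) := by
        rw [hx, smul_smul, inv_mul_cancel₀ hνpos.ne', one_smul]
      rw [hx2, hfin, map_sum]
      refine Submodule.smul_mem _ _ (Submodule.sum_mem _ fun k hk => ?_)
      rw [map_smul, hadj]
      refine Submodule.smul_mem _ _ (Submodule.smul_mem _ _ (Submodule.subset_span ?_))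
      exact Finset.mem_coe.2 (Finset.mem_image_of_mem u hk)
    have h1 := (hs.trans (Submodule.rank_mono hsub)).trans (rank_span_finset_le _)
    have h2 : i + 1 ≤ ((Finset.range i).image u).card := by exact_mod_cast h1
    have h3 : ((Finset.range i).image u).card ≤ i := by
      simpa using Finset.card_image_le (s := Finset.range i) (f := u)
    omega

end SingularValues

end HausdorffMoment

end

noncomputable section

namespace HausdorffMoment

/-! ### Bounds for singular values from Hilbert–Schmidt tails -/

section Abstract

variable {E F : Type*} [NormedAddCommGroup E] [InnerProductSpace ℝ E]
  [NormedAddCommGroup F] [InnerProductSpace ℝ F]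

/-! Upper bounds come from Hilbert–Schmidt tails. If `m` vectors `w l` leave squared Hilbert–Schmidt
norm at most `C` on their orthogonal complement, then `(i - m) * σ_i ^ 2 ≤ C`
(`TailBound.mul_sq_le`): an `i`-dimensional space on which `T` expands by at least `σ_i` meets the
complement in dimension at least `i - m`. With `m` about `i / 2`, a tail `C` of order `1 / i` gives
`σ_i = O(1 / i)`, and order `1 / i ^ 2` gives `O(i ^ (-3/2))`.

For `J`, orthogonality to indicators on a uniform grid makes primitives vanish at the nodes, with
tail `1 / (m + 1)`. For `B ∘L J`, integration by parts turns moments of `J x` into pairings of `x`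
with monomials; orthogonality to the first `M` monomials leaves tail at most `1 / M ^ 2`.

The lower bound for `J` uses the eigenfunctions `cos ((k + 1/2) π t)` of `J* J`. Compactness of `J`
follows from tails tending to zero; `B` fails to be compact on normalized monomials. -/

/-- On the orthogonal complement of the vectors `w l`, the squared Hilbert–Schmidt norm of `T`
is at most `C`. -/
def TailBound (T : E →L[ℝ] F) {m : ℕ} (w : Fin m → E) (C : ℝ) : Prop :=
  ∀ (n : ℕ) (e : Fin n → E), Orthonormal ℝ e → (∀ k l, inner ℝ (w l) (e k) = 0) →
    ∑ k, ‖T (e k)‖ ^ 2 ≤ C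

theorem TailBound.norm_sq_le {T : E →L[ℝ] F} {m : ℕ} {w : Fin m → E} {C : ℝ}
    (h : TailBound T w C) {x : E} (hx : ∀ l, inner ℝ (w l) x = 0) :
    ‖T x‖ ^ 2 ≤ C * ‖x‖ ^ 2 := by
  rcases eq_or_ne x 0 with rfl | hx0
  · simp
  have hn : ‖x‖ ≠ 0 := norm_ne_zero_iff.2 hx0
  have h1 := h 1 (fun _ => ‖x‖⁻¹ • x)
    ⟨fun _ => by simp [norm_smul, hn], fun i j hij => (hij (Subsingleton.elim i j)).elim⟩
    (fun _ l => by rw [real_inner_smul_right, hx l, mul_zero])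
  simp only [map_smul, norm_smul, Finset.univ_unique, Finset.sum_singleton, norm_inv, norm_norm,
    mul_pow] at h1
  rwa [inv_pow, inv_mul_le_iff₀ (by positivity), mul_comm] at h1

/-- Compact operators are closed in operator norm, and composing `T` with the projection onto the
span of `w` gives a finite-rank approximation with error at most `√ε`. -/
theorem isCompactOperator_of_tailBound [CompleteSpace F] (T : E →L[ℝ] F)
    (h : ∀ ε : ℝ, 0 < ε → ∃ (m : ℕ) (w : Fin m → E), TailBound T w ε) : IsCompactOperator T := by
  have hcl := isClosed_setOfPred_isCompactOperator (σ₁₂ := RingHom.id ℝ) (M₁ := E) (M₂ := F)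
  refine hcl.closure_subset (Metric.mem_closure_iff.2 fun ε hε => ?_)
  obtain ⟨m, w, hw⟩ := h ((ε / 2) ^ 2) (by positivity)
  set W := Submodule.span ℝ (Set.range w)
  have : FiniteDimensional ℝ W := FiniteDimensional.span_of_finite ℝ (Set.finite_range w)
  refine ⟨T ∘L W.starProjection, ?_, ?_⟩
  · have h1 : IsCompactOperator W.subtypeL :=
      isCompactOperator_of_locallyCompactSpace_rng (W.subtypeL)
    exact (h1.clm_comp T).comp_clm W.orthogonalProjectionOnto
  · rw [dist_eq_norm]
    refine lt_of_le_of_lt (ContinuousLinearMap.opNorm_le_bound _ (by positivity : 0 ≤ ε / 2)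
      fun x => ?_) (half_lt_self hε)
    have hx := hw.norm_sq_le (x := x - W.starProjection x) fun l =>
      W.sub_starProjection_mem_orthogonal x (w l) (Submodule.subset_span ⟨l, rfl⟩)
    have hle : ‖x - W.starProjection x‖ ≤ ‖x‖ := by
      have := Submodule.norm_sq_eq_add_norm_sq_starProjection x W
      rw [Submodule.starProjection_orthogonal_val] at this
      nlinarith [norm_nonneg x, norm_nonneg (x - W.starProjection x),
        sq_nonneg ‖W.starProjection x‖]
    have e : (T - T ∘L W.starProjection) x = T (x - W.starProjection x) := by simp
    rw [e]
    rw [← mul_pow] at hx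
    exact (pow_le_pow_iff_left₀ (norm_nonneg _) (by positivity) two_ne_zero).1 hx |>.trans
      (mul_le_mul_of_nonneg_left hle (by positivity))

/-! ### Singular values against tails and eigenvectors -/

variable [CompleteSpace E] [CompleteSpace F]

/-- Each vector is a finite sum of eigenvectors from mutually orthogonal eigenspaces of `T* T`, so
Pythagoras gives `‖T x‖ ^ 2 = ∑ ν ‖x_ν‖ ^ 2` with every `ν ≥ r`. -/
theorem mul_norm_sq_le_of_mem_eigenspaceGE (T : E →L[ℝ] F) {r : ℝ} {x : E}
    (hx : x ∈ eigenspaceGE T r) : r * ‖x‖ ^ 2 ≤ ‖T x‖ ^ 2 := by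
  set A : E →ₗ[ℝ] E := ((ContinuousLinearMap.adjoint T ∘L T : E →L[ℝ] E) : E →ₗ[ℝ] E) with hA
  have hsymm : A.IsSymmetric := fun a b => by
    simp [hA, ContinuousLinearMap.adjoint_inner_left, ContinuousLinearMap.adjoint_inner_right]
  have hort : OrthogonalFamily ℝ (fun ν : Set.Ici r => Module.End.eigenspace A (ν : ℝ))
      fun ν => (Module.End.eigenspace A (ν : ℝ)).subtypeₗᵢ :=
    hsymm.orthogonalFamily_eigenspaces.comp Subtype.coe_injective
  obtain ⟨f, hf, rfl⟩ := (Submodule.mem_iSup_iff_exists_finsupp _ _).1 hx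
  set l : ∀ ν : Set.Ici r, Module.End.eigenspace A (ν : ℝ) := fun ν => ⟨f ν, hf ν⟩
  have hsum : (f.sum fun _ y => y) = ∑ ν ∈ f.support,
      (Module.End.eigenspace A (ν : ℝ)).subtypeₗᵢ (l ν) := rfl
  have hAsum : A (f.sum fun _ y => y) = ∑ ν ∈ f.support,
      (Module.End.eigenspace A (ν : ℝ)).subtypeₗᵢ ((ν : ℝ) • l ν) := by
    rw [hsum, map_sum]
    refine Finset.sum_congr rfl fun ν _ => ?_
    exact Module.End.mem_eigenspace_iff.1 (hf ν)
  have h1 : ‖T (f.sum fun _ y => y)‖ ^ 2 =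
      inner ℝ (A (f.sum fun _ y => y)) (f.sum fun _ y => y) := by
    simp [hA, ContinuousLinearMap.adjoint_inner_left]
  rw [h1, hAsum, hsum, hort.inner_sum, hort.norm_sum, Finset.mul_sum]
  refine Finset.sum_le_sum fun ν _ => ?_
  rw [real_inner_smul_left, real_inner_self_eq_norm_sq]
  exact mul_le_mul_of_nonneg_right ν.2 (sq_nonneg _)

theorem TailBound.mul_sq_le {T : E →L[ℝ] F} {m : ℕ} {w : Fin m → E} {C : ℝ}
    (h : TailBound T w C) {i : ℕ} {s : ℝ}
    (hi : (i : Cardinal) ≤ Module.rank ℝ (eigenspaceGE T (s ^ 2))) :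
    ((i - m : ℕ) : ℝ) * s ^ 2 ≤ C := by
  obtain ⟨t, ht, hli⟩ := le_rank_iff_exists_linearIndependent_finset.1 hi
  set W : Submodule ℝ (eigenspaceGE T (s ^ 2)) := Submodule.span ℝ (t : Set _)
  have hW : Module.finrank ℝ W = i := by
    rw [← ht]; exact finrank_span_finset_eq_card hli
  have : FiniteDimensional ℝ W := FiniteDimensional.span_finset ℝ t
  let inc : W →ₗᵢ[ℝ] E := (eigenspaceGE T (s ^ 2)).subtypeₗᵢ.comp W.subtypeₗᵢ
  -- The kernel of `L` is the part of `W` orthogonal to every `w l`; rank–nullity costs at most `m`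
  -- dimensions.
  let L : W →ₗ[ℝ] (Fin m → ℝ) :=
    LinearMap.pi fun l => (innerSL ℝ (w l)).toLinearMap ∘ₗ inc.toLinearMap
  set U : Submodule ℝ E := (LinearMap.ker L).map inc.toLinearMap
  have hU : i - m ≤ Module.finrank ℝ U := by
    have h1 := L.finrank_range_add_finrank_ker
    have h2 : Module.finrank ℝ (LinearMap.range L) ≤ m := by
      simpa using (LinearMap.range L).finrank_le
    have h3 : Module.finrank ℝ U = Module.finrank ℝ (LinearMap.ker L) :=
      (Submodule.equivMapOfInjective inc.toLinearMap inc.injective _).finrank_eq.symm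
    omega
  let b := stdOrthonormalBasis ℝ U
  have he : Orthonormal ℝ fun k => (b k : E) := b.orthonormal.comp_linearIsometry U.subtypeₗᵢ
  have hb := h _ (fun k => (b k : E)) he fun k l => by
    obtain ⟨y, hy, hyk⟩ := (b k).2
    rw [← hyk]
    exact congrFun (LinearMap.mem_ker.1 hy) l
  refine le_trans ?_ hb
  have hterm : ∀ k, s ^ 2 ≤ ‖T (b k : E)‖ ^ 2 := fun k => by
    obtain ⟨y, -, hyk⟩ := (b k).2
    have := mul_norm_sq_le_of_mem_eigenspaceGE T (x := (b k : E))
      (by rw [← hyk]; exact (y : W).1.2)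
    simpa [he.1 k] using this
  calc ((i - m : ℕ) : ℝ) * s ^ 2
      ≤ (Module.finrank ℝ U : ℝ) * s ^ 2 :=
        mul_le_mul_of_nonneg_right (by exact_mod_cast hU) (sq_nonneg _)
    _ = ∑ _k : Fin (Module.finrank ℝ U), s ^ 2 := by simp
    _ ≤ _ := Finset.sum_le_sum fun k _ => hterm k

/-- Makes the supremum in `singularValue` one of a bounded set; for `i = 0` the rank condition is
vacuous and this fails. -/
theorem le_opNorm_of_le_rank_eigenspaceGE (T : E →L[ℝ] F) {i : ℕ} (hi : 1 ≤ i) {s : ℝ}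
    (hs : (i : Cardinal) ≤ Module.rank ℝ (eigenspaceGE T (s ^ 2))) : s ≤ ‖T‖ := by
  have hpos : 0 < Module.rank ℝ (eigenspaceGE T (s ^ 2)) :=
    lt_of_lt_of_le (by exact_mod_cast hi) hs
  obtain ⟨x, hx⟩ := rank_pos_iff_exists_ne_zero.1 hpos
  have h0 : 0 < ‖(x : E)‖ := norm_pos_iff.2 (by simpa using hx)
  have h1 := mul_norm_sq_le_of_mem_eigenspaceGE T x.2
  have h2 := pow_le_pow_left₀ (norm_nonneg _) (T.le_opNorm x) 2
  rw [mul_pow] at h2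
  exact le_of_sq_le_sq (le_of_mul_le_mul_right (h1.trans h2) (by positivity)) (norm_nonneg _)

theorem singularValue_le (T : E →L[ℝ] F) {i : ℕ} {C : ℝ} (hC : 0 ≤ C)
    (h : ∀ s : ℝ, 0 ≤ s → (i : Cardinal) ≤ Module.rank ℝ (eigenspaceGE T (s ^ 2)) → s ≤ C) :
    singularValue T i ≤ C :=
  Real.sSup_le (fun s hs => h s hs.1 hs.2) hC

/-- `hT` is the weak form of `T* T u_k = σ_k ^ 2 u_k`. Strict monotonicity separates the
eigenvalues, so independence is automatic; completeness of the system is not needed for a lower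
bound. -/
theorem le_singularValue (T : E →L[ℝ] F) (σ : ℕ → ℝ) (hσ : StrictAnti σ) (hσ0 : ∀ k, 0 < σ k)
    (u : ℕ → E) (hu : ∀ k, u k ≠ 0)
    (hT : ∀ k x, inner ℝ (T (u k)) (T x) = σ k ^ 2 * inner ℝ (u k) x) (i : ℕ) :
    σ i ≤ singularValue T (i + 1) := by
  have heig : ∀ k, Module.End.HasEigenvector
      ((ContinuousLinearMap.adjoint T ∘L T : E →L[ℝ] E) : E →ₗ[ℝ] E) (σ k ^ 2) (u k) := by
    refine fun k => ⟨Module.End.mem_eigenspace_iff.2 (ext_inner_right ℝ fun x => ?_), hu k⟩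
    simp [ContinuousLinearMap.adjoint_inner_left, hT, real_inner_smul_left]
  have hinj : Function.Injective fun k => σ k ^ 2 := fun a b hab =>
    hσ.injective ((pow_left_inj₀ (hσ0 a).le (hσ0 b).le two_ne_zero).1 hab)
  have hli := Module.End.eigenvectors_linearIndependent' _ _ hinj u heig
  have hmem : ∀ k : Fin (i + 1), u k ∈ eigenspaceGE T (σ i ^ 2) := fun k =>
    Submodule.mem_iSup_of_mem (⟨σ k ^ 2, pow_le_pow_left₀ (hσ0 i).le
      (hσ.antitone (Nat.lt_succ_iff.1 k.2)) 2⟩ : Set.Ici (σ i ^ 2)) (heig k).1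
  have hw : LinearIndependent ℝ fun k : Fin (i + 1) => (⟨u k, hmem k⟩ : eigenspaceGE T (σ i ^ 2)) :=
    LinearIndependent.of_comp (eigenspaceGE T (σ i ^ 2)).subtype
      (hli.comp (fun k : Fin (i + 1) => (k : ℕ)) Fin.val_injective)
  exact le_csSup ⟨‖T‖, fun s hs => le_opNorm_of_le_rank_eigenspaceGE T (Nat.le_add_left 1 i) hs.2⟩
    ⟨(hσ0 i).le, by simpa using hw.cardinal_lift_le_rank⟩

end Abstract

/-! ### The integration operator -/

theorem intervalIntegrable_coe (x : L2) : IntervalIntegrable (fun t => x t) volume 0 1 := by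
  rw [intervalIntegrable_iff_integrableOn_Icc_of_le zero_le_one]
  exact integrableOn_Icc x

theorem integral_unitVol (f : ℝ → ℝ) : ∫ t, f t ∂unitVol = ∫ t in (0 : ℝ)..1, f t := by
  rw [intervalIntegral.integral_of_le zero_le_one, integral_Ioc_eq_integral_Ioo]

theorem inner_toLp {f : ℝ → ℝ} (hf : MemLp f 2 unitVol) (x : L2) :
    inner ℝ (hf.toLp f) x = ∫ t in (0 : ℝ)..1, f t * x t := by
  rw [L2.inner_def, ← integral_unitVol]
  refine integral_congr_ae ?_
  filter_upwards [hf.coeFn_toLp] with t ht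
  simp [ht, mul_comm]

/-- Integration by parts against the primitive of a square integrable function. -/
theorem integral_mul_J {g g' : ℝ → ℝ} (hg : ∀ t, HasDerivAt g (g' t) t) (hg' : Continuous g')
    (x : L2) : ∫ s in (0 : ℝ)..1, g' s * J x s =
      g 1 * (∫ t in (0 : ℝ)..1, x t) - ∫ t in (0 : ℝ)..1, g t * x t := by
  have hder : deriv g = g' := funext fun t => (hg t).deriv
  have hgC : ContDiff ℝ 1 g :=
    contDiff_one_iff_deriv.2 ⟨fun t => (hg t).differentiableAt, hder ▸ hg'⟩
  have hi := intervalIntegrable_coe x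
  -- The primitive of an `L²` function is only absolutely continuous and differentiable almost
  -- everywhere.
  have hparts := AbsolutelyContinuousOnInterval.integral_mul_deriv_eq_deriv_mul
    hgC.contDiffOn.absolutelyContinuousOnInterval
    (hi.absolutelyContinuousOnInterval_intervalIntegral (c := 0) (by simp))
  have h1 : ∫ t in (0 : ℝ)..1, g t * deriv (fun s => ∫ v in (0 : ℝ)..s, x v) t =
      ∫ t in (0 : ℝ)..1, g t * x t := by
    refine intervalIntegral.integral_congr_ae ?_
    filter_upwards [hi.ae_hasDerivAt_integral] with t ht hmem
    rw [(ht (Set.uIoc_subset_uIcc hmem) 0 (by simp)).deriv]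
  have h2 : ∫ s in (0 : ℝ)..1, g' s * J x s =
      ∫ s in (0 : ℝ)..1, deriv g s * ∫ v in (0 : ℝ)..s, x v := by
    rw [← integral_unitVol, ← integral_unitVol, hder]
    refine integral_congr_ae ?_
    filter_upwards [J_apply_ae x] with s hs
    rw [hs]
  rw [h1] at hparts
  rw [h2]
  simp only [intervalIntegral.integral_same, mul_zero, sub_zero] at hparts
  linarith

/-! ### Tail and upper bound for the integration operator -/

/-- The indicator function of `(r, s]` as an element of `L²(0,1)`. -/
def ind (r s : ℝ) : L2 :=
  indicatorConstLp 2 (measurableSet_Ioc (a := r) (b := s)) (measure_ne_top unitVol _) 1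

theorem inner_ind {r s : ℝ} (hr : 0 ≤ r) (hrs : r ≤ s) (hs : s < 1) (x : L2) :
    inner ℝ (ind r s) x = ∫ t in r..s, x t := by
  have hsub : Set.Ioc r s ⊆ Set.Ioo 0 1 := fun t ht => ⟨hr.trans_lt ht.1, ht.2.trans_lt hs⟩
  rw [ind, L2.inner_indicatorConstLp_one, Measure.restrict_restrict measurableSet_Ioc,
    Set.inter_eq_left.2 hsub,
    intervalIntegral.integral_of_le hrs]

theorem norm_ind_sq_le {r s : ℝ} (hrs : r ≤ s) : ‖ind r s‖ ^ 2 ≤ s - r := by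
  rw [ind, norm_indicatorConstLp (by norm_num) (by norm_num), norm_one, one_mul,
    ← Real.rpow_natCast, ← Real.rpow_mul measureReal_nonneg]
  simp only [ENNReal.toReal_ofNat, Nat.cast_ofNat, one_div, ne_eq, OfNat.ofNat_ne_zero,
    not_false_eq_true, inv_mul_cancel₀, Real.rpow_one]
  refine (ENNReal.toReal_mono (by simp) (Measure.restrict_apply_le _ _)).trans ?_
  rw [Real.volume_Ioc, ENNReal.toReal_ofReal (by linarith)]

/-- The primitive of each `e k` vanishes at the grid nodes, so its value at `s` is the pairing with
the indicator from the last node to `s`, of length at most `1 / (m + 1)`. Bessel bounds the sum over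
`k` pointwise; then integrate in `s`. -/
theorem tailBound_J (m : ℕ) :
    TailBound J (fun l : Fin m => ind 0 (((l : ℕ) + 1 : ℝ) / (m + 1))) (1 / (m + 1)) := by
  intro n e he hw
  have hm : (0 : ℝ) < m + 1 := by positivity
  have hpt : ∀ s ∈ Set.Ioo (0 : ℝ) 1,
      ∑ k, (∫ t in (0 : ℝ)..s, e k t) ^ 2 ≤ 1 / ((m : ℝ) + 1) := by
    intro s hs
    set a := ⌊s * (m + 1)⌋₊ with ha
    have h1 : (a : ℝ) ≤ s * (m + 1) := Nat.floor_le (by have := hs.1; positivity)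
    have h2 : s * (m + 1) < a + 1 := Nat.lt_floor_add_one _
    have ham : a < m + 1 := by
      rw [ha, Nat.floor_lt (by have := hs.1; positivity)]
      push_cast
      nlinarith [hs.2]
    have hr0 : (0 : ℝ) ≤ a / (m + 1) := by positivity
    have hrs : (a : ℝ) / (m + 1) ≤ s := (div_le_iff₀ hm).2 h1
    have hr1 : (a : ℝ) / (m + 1) < 1 := hrs.trans_lt hs.2
    have hzero : ∀ k, ∫ t in (0 : ℝ)..a / (m + 1), e k t = 0 := by
      intro k
      -- Node `0` is trivial; node `a > 0` belongs to index `a - 1`.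
      rcases Nat.eq_zero_or_pos a with h0 | h0
      · simp [h0]
      · have hl := hw k ⟨a - 1, by omega⟩
        have hc : ((a - 1 : ℕ) : ℝ) + 1 = a := by
          rw [Nat.cast_sub h0]; simp
        simp only [hc] at hl
        rwa [inner_ind le_rfl hr0 hr1] at hl
    have hk : ∀ k, ∫ t in (0 : ℝ)..s, e k t = inner ℝ (e k) (ind (a / (m + 1)) s) := by
      intro k
      have hi := intervalIntegrable_of_mem (e k) hs
      have hmem : (a : ℝ) / (m + 1) ∈ Set.uIcc 0 s := by
        rw [Set.uIcc_of_le hs.1.le]; exact ⟨hr0, hrs⟩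
      rw [real_inner_comm, inner_ind hr0 hrs hs.2, ← intervalIntegral.integral_add_adjacent_intervals
        (hi.mono_set (Set.uIcc_subset_uIcc_left hmem))
        (hi.mono_set (Set.uIcc_subset_uIcc_right hmem)), hzero, zero_add]
    have hb := he.sum_inner_products_le (ind (a / (m + 1)) s) (s := Finset.univ)
    simp only [Real.norm_eq_abs, sq_abs] at hb
    simp only [hk]
    refine (hb.trans (norm_ind_sq_le hrs)).trans ?_
    rw [sub_le_iff_le_add, ← add_div, le_div_iff₀ hm]
    linarith
  have hnorm : ∀ k, ‖J (e k)‖ ^ 2 = ∫ s, J (e k) s ^ 2 ∂unitVol := by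
    intro k
    rw [← real_inner_self_eq_norm_sq, L2.inner_def]
    simp [sq]
  have hint : ∀ k, Integrable (fun s => J (e k) s ^ 2) unitVol := fun k =>
    (Lp.memLp (J (e k))).integrable_sq
  simp only [hnorm]
  rw [← integral_finsetSum _ fun k _ => hint k]
  calc ∫ s, ∑ k, J (e k) s ^ 2 ∂unitVol ≤ ∫ _s, 1 / ((m : ℝ) + 1) ∂unitVol := by
        refine integral_mono_ae (integrable_finsetSum _ fun k _ => hint k)
          (integrable_const _) ?_
        filter_upwards [ae_all_iff.2 fun k => J_apply_ae (e k),
          ae_restrict_mem measurableSet_Ioo] with s hs hmem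
        simp only [hs]
        exact hpt s hmem
    _ = 1 / (m + 1) := by simp

theorem isCompactOperator_J : IsCompactOperator J := by
  refine isCompactOperator_of_tailBound J fun ε hε => ?_
  obtain ⟨m, hm⟩ := exists_nat_one_div_lt hε
  exact ⟨m, _, fun n e he hw => (tailBound_J m n e he hw).trans hm.le⟩

theorem singularValue_J_le {i : ℕ} (hi : 1 ≤ i) : singularValue J i ≤ 2 / i := by
  have hi0 : (0 : ℝ) < i := by exact_mod_cast hi
  refine singularValue_le J (by positivity) fun s hs h => ?_
  -- With `m = i / 2`, both `i - m` and `m + 1` are at least half of `i`, whence `i ^ 2 * s ^ 2 ≤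
  -- 4`.
  have h1 := (tailBound_J (i / 2)).mul_sq_le h
  have h2 : (i : ℝ) ≤ 2 * ((i - i / 2 : ℕ) : ℝ) := by exact_mod_cast (by omega)
  have h3 : (i : ℝ) ≤ 2 * (((i / 2 : ℕ) : ℝ) + 1) := by exact_mod_cast (by omega)
  rw [le_div_iff₀ (by positivity)] at h1
  rw [le_div_iff₀ hi0]
  refine le_of_sq_le_sq ?_ zero_le_two
  nlinarith [mul_le_mul h2 h3 hi0.le (by positivity), sq_nonneg s]

/-! ### Singular functions of the integration operator -/

/-- The `k`-th singular value `1 / ((k + 1/2) π)` is the reciprocal of this frequency. -/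
def freq (k : ℕ) : ℝ := (k + 1 / 2) * Real.pi

theorem freq_pos (k : ℕ) : 0 < freq k := by unfold freq; positivity

theorem cos_freq (k : ℕ) : Real.cos (freq k) = 0 :=
  Real.cos_eq_zero_iff.2 ⟨k, by unfold freq; push_cast; ring⟩

theorem memLp_cos (a : ℝ) : MemLp (fun t : ℝ => Real.cos (a * t)) 2 unitVol :=
  MemLp.of_bound (by fun_prop) 1 (Filter.Eventually.of_forall fun _ => Real.abs_cos_le_one _)

/-- The function `t ↦ cos (a t)` as an element of `L²(0,1)`. -/
def cosine (a : ℝ) : L2 := (memLp_cos a).toLp _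

theorem integral_cos_mul {a : ℝ} (ha : a ≠ 0) (s : ℝ) :
    ∫ t in (0 : ℝ)..s, Real.cos (a * t) = Real.sin (a * s) / a := by
  rw [intervalIntegral.integral_comp_mul_left _ ha]
  simp [div_eq_inv_mul]

theorem J_cosine_ae {a : ℝ} (ha : a ≠ 0) :
    ∀ᵐ s ∂unitVol, J (cosine a) s = Real.sin (a * s) / a := by
  have hc := (ae_restrict_iff' measurableSet_Ioo).1 (memLp_cos a).coeFn_toLp
  filter_upwards [J_apply_ae (cosine a), ae_restrict_mem measurableSet_Ioo] with s hs hmem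
  rw [hs, ← integral_cos_mul ha]
  refine intervalIntegral.integral_congr_ae ?_
  filter_upwards [hc] with t ht hts
  rw [Set.uIoc_of_le hmem.1.le] at hts
  exact ht ⟨hts.1, hts.2.trans_lt hmem.2⟩

/-- Integrate `sin (a s) / a` by parts against `J x`: the boundary term at `1` vanishes because `cos
a = 0`, the one at `0` because the primitive does. -/
theorem inner_J_cosine (k : ℕ) (x : L2) :
    inner ℝ (J (cosine (freq k))) (J x) = (1 / freq k) ^ 2 * inner ℝ (cosine (freq k)) x := by
  have ha := (freq_pos k).ne'
  set a := freq k with hadef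
  have h1 : inner ℝ (J (cosine a)) (J x) =
      ∫ s in (0 : ℝ)..1, Real.sin (a * s) / a * J x s := by
    rw [L2.inner_def, ← integral_unitVol]
    refine integral_congr_ae ?_
    filter_upwards [J_cosine_ae ha] with s hs
    simp [hs, mul_comm]
  have hg : ∀ t, HasDerivAt (fun t => -(Real.cos (a * t) / a ^ 2)) (Real.sin (a * t) / a) t := by
    intro t
    have := (((hasDerivAt_id t).const_mul a).cos.div_const (a ^ 2)).neg
    refine this.congr_deriv ?_
    simp only [id]
    field_simp
  rw [h1, integral_mul_J hg (by fun_prop), cosine, inner_toLp, mul_one, hadef, cos_freq,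
    zero_div, neg_zero, zero_mul, zero_sub, ← intervalIntegral.integral_neg,
    ← intervalIntegral.integral_const_mul]
  congr 1
  ext t
  ring

theorem cosine_freq_ne_zero (k : ℕ) : cosine (freq k) ≠ 0 := by
  intro h0
  -- Pairing with the constant `1` detects nonvanishing: `cos a = 0` forces `sin a ≠ 0`.
  have h1 : inner ℝ (cosine (freq k)) (mono 0) = Real.sin (freq k) / freq k := by
    have h2 := integral_cos_mul (freq_pos k).ne' 1
    rw [mul_one] at h2
    rw [cosine, inner_toLp, ← h2, ← integral_unitVol, ← integral_unitVol]
    refine integral_congr_ae ?_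
    filter_upwards [(memLp_pow 0).coeFn_toLp] with t ht
    rw [mono, ht, pow_zero, mul_one]
  rw [h0, inner_zero_left, eq_comm, div_eq_zero_iff, or_iff_left (freq_pos k).ne'] at h1
  have h2 := Real.sin_sq_add_cos_sq (freq k)
  rw [h1, cos_freq] at h2
  norm_num at h2

theorem le_singularValue_J {i : ℕ} (hi : 1 ≤ i) : 1 / Real.pi / i ≤ singularValue J i := by
  obtain ⟨k, rfl⟩ := Nat.exists_eq_add_of_le' hi
  have hanti : StrictAnti fun k => 1 / freq k := fun a b hab => by
    refine one_div_lt_one_div_of_lt (freq_pos a) ?_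
    have : (a : ℝ) < b := by exact_mod_cast hab
    exact mul_lt_mul_of_pos_right (by linarith) Real.pi_pos
  refine le_trans ?_ (le_singularValue J (fun k => 1 / freq k) hanti
    (fun k => one_div_pos.2 (freq_pos k)) (fun k => cosine (freq k)) cosine_freq_ne_zero
    inner_J_cosine k)
  rw [div_div]
  refine one_div_le_one_div_of_le (freq_pos k) ?_
  rw [freq, mul_comm]
  push_cast
  exact mul_le_mul_of_nonneg_left (by linarith) Real.pi_pos.le

/-! ### The Hausdorff moment operator -/

/-- The unit vectors `√(2n + 1) t ^ n` have images with norms bounded below but every coordinate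
tending to `0`, so no subsequence of the images can converge. -/
theorem not_isCompactOperator_B : ¬ IsCompactOperator B := by
  intro hB
  set z : ℕ → L2 := fun n => √(2 * n + 1) • mono n with hz
  have hBz : ∀ n j : ℕ, B (z n) j = √(2 * n + 1) / (n + j + 1) := by
    intro n j
    change moment (z n) j = _
    rw [moment_eq_inner, hz, real_inner_smul_right, inner_mono]
    ring
  have hzn : ∀ n, z n ∈ Metric.closedBall (0 : L2) 1 := by
    intro n
    rw [mem_closedBall_zero_iff, ← sq_le_one_iff₀ (norm_nonneg _), ← real_inner_self_eq_norm_sq,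
      hz, real_inner_smul_left, real_inner_smul_right, inner_mono, ← mul_assoc,
      Real.mul_self_sqrt (by positivity), ← two_mul, mul_one_div_cancel (by positivity)]
  -- Each of the first `n + 1` squared coordinates is at least `1 / (2n + 1)`.
  have hlow : ∀ n, 1 / 2 ≤ ‖B (z n)‖ ^ 2 := by
    intro n
    have h := lp.sum_rpow_le_norm_rpow (p := 2) (by norm_num) (B (z n)) (Finset.range (n + 1))
    simp only [ENNReal.toReal_ofNat, Real.rpow_ofNat, Real.norm_eq_abs, sq_abs] at h
    refine le_trans ?_ h
    calc (1 / 2 : ℝ) ≤ ∑ _j ∈ Finset.range (n + 1), 1 / (2 * (n : ℝ) + 1) := by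
          rw [Finset.sum_const, Finset.card_range, nsmul_eq_mul, mul_one_div,
            div_le_div_iff₀ (by norm_num) (by positivity)]
          push_cast
          linarith
      _ ≤ _ := by
          refine Finset.sum_le_sum fun j hj => ?_
          have hjn : (j : ℝ) ≤ n := by exact_mod_cast Nat.lt_succ_iff.1 (Finset.mem_range.1 hj)
          rw [hBz, div_pow, Real.sq_sqrt (by positivity),
            div_le_div_iff₀ (by positivity) (by positivity), one_mul, ← sq]
          exact pow_le_pow_left₀ (by positivity) (by linarith) 2
  obtain ⟨K, hK, hsub⟩ := IsCompactOperator.image_closedBall_subset_compact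
    (f := (B : L2 →ₗ[ℝ] ell2)) hB 1
  obtain ⟨y, -, φ, hφ, hlim⟩ := hK.tendsto_subseq fun n => hsub ⟨z n, hzn n, rfl⟩
  have hy : y = 0 := by
    ext j
    have h1 : Filter.Tendsto (fun n => B (z (φ n)) j) Filter.atTop (nhds (y j)) :=
      ((continuous_apply j).comp lp.uniformContinuous_coe.continuous).continuousAt.tendsto.comp hlim
    have h2 : Filter.Tendsto (fun n : ℕ => B (z n) j) Filter.atTop (nhds 0) := by
      have h3 : Filter.Tendsto (fun n : ℕ => 2 / √((n : ℝ))) Filter.atTop (nhds 0) :=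
        tendsto_const_nhds.div_atTop
          (Real.tendsto_sqrt_atTop.comp tendsto_natCast_atTop_atTop)
      refine squeeze_zero' (Filter.Eventually.of_forall fun n => ?_)
        (Filter.eventually_gt_atTop 0 |>.mono fun n hn => ?_) h3
      · rw [hBz]; positivity
      · have hn' : (1 : ℝ) ≤ n := by exact_mod_cast hn
        rw [hBz, div_le_div_iff₀ (by positivity) (by positivity), ← Real.sqrt_mul (by positivity)]
        refine Real.sqrt_le_iff.2 ⟨by positivity, ?_⟩
        have : (0 : ℝ) ≤ j := by positivity
        nlinarith
    exact tendsto_nhds_unique h1 (h2.comp hφ.tendsto_atTop)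
  have hn := (hlim.norm.pow 2)
  rw [hy, norm_zero] at hn
  have := ge_of_tendsto hn (Filter.Eventually.of_forall fun n => hlow (φ n))
  norm_num at this

/-! ### The composition -/

theorem moment_J (x : L2) (j : ℕ) :
    moment (J x) j = (inner ℝ (mono 0) x - inner ℝ (mono (j + 1)) x) / (j + 1) := by
  have hj : ((j : ℝ) + 1) ≠ 0 := by positivity
  have hg : ∀ t : ℝ, HasDerivAt (fun t => t ^ (j + 1) / ((j : ℝ) + 1)) (t ^ j) t := by
    intro t
    refine ((hasDerivAt_pow (j + 1) t).div_const _).congr_deriv ?_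
    push_cast
    field_simp
  have h := integral_mul_J hg (by fun_prop) x
  rw [moment, integral_unitVol, h, mono, mono, inner_toLp, inner_toLp, sub_div]
  simp only [one_pow, pow_zero, one_mul, div_mul_eq_mul_div, intervalIntegral.integral_div]

theorem sum_tail_le (M N : ℕ) (hM : 1 ≤ M) :
    ∑ j ∈ Finset.range N, (if j + 1 < M then 0 else
      1 / (((j : ℝ) + 1) ^ 2 * (2 * ((j : ℝ) + 1) + 1))) ≤ 1 / (M : ℝ) ^ 2 := by
  have hM0 : (0 : ℝ) < M := by exact_mod_cast hM
  -- Telescoping: with `y = j + 1`, each term is at most `1 / y ^ 2 - 1 / (y + 1) ^ 2`. The `max`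
  -- keeps the bound at zero until the sum reaches `M`.
  suffices h : ∑ j ∈ Finset.range N, (if j + 1 < M then 0 else
      1 / (((j : ℝ) + 1) ^ 2 * (2 * ((j : ℝ) + 1) + 1))) ≤
      1 / (M : ℝ) ^ 2 - 1 / (max (M : ℝ) (N + 1)) ^ 2 by
    exact h.trans (sub_le_self _ (by positivity))
  induction N with
  | zero =>
    have : max (M : ℝ) ((0 : ℕ) + 1) = M := max_eq_left (by simpa using hM)
    rw [this]
    simp
  | succ N ih =>
    rw [Finset.sum_range_succ]
    refine (add_le_add_left ih _).trans ?_
    push_cast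
    split_ifs with hlt
    · have h1 : (N : ℝ) + 1 + 1 ≤ M := by exact_mod_cast hlt
      rw [max_eq_left h1, max_eq_left (by linarith), add_zero]
    · have h1 : (M : ℝ) ≤ N + 1 := by exact_mod_cast not_lt.1 hlt
      rw [max_eq_right h1, max_eq_right (by linarith)]
      set y : ℝ := (N : ℝ) + 1
      have hy : 0 < y := by positivity
      have e : 1 / y ^ 2 - 1 / (y + 1) ^ 2 = (2 * y + 1) / (y ^ 2 * (y + 1) ^ 2) := by
        field_simp
        ring
      have h2 : 1 / (y ^ 2 * (2 * y + 1)) ≤ (2 * y + 1) / (y ^ 2 * (y + 1) ^ 2) := by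
        rw [div_le_div_iff₀ (by positivity) (by positivity)]
        have : y ^ 2 * (y + 1) ^ 2 ≤ y ^ 2 * (2 * y + 1) ^ 2 := by gcongr; linarith
        linarith
      linarith

/-- Orthogonality to `mono 0` removes the boundary term of `moment_J`, and orthogonality to the
others kills the moments with `j + 1 < M`. For the rest, Bessel gives `‖t ^ (j + 1)‖ ^ 2 / (j + 1) ^
2`, summed by `sum_tail_le`. -/
theorem tailBound_B_comp_J (M : ℕ) (hM : 1 ≤ M) :
    TailBound (B ∘L J) (fun l : Fin M => mono l) (1 / (M : ℝ) ^ 2) := by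
  intro n e he hw
  have hsum : HasSum (fun j => ∑ k, moment (J (e k)) j ^ 2) (∑ k, ‖(B ∘L J) (e k)‖ ^ 2) := by
    refine hasSum_sum fun k _ => ?_
    have h := lp.hasSum_norm (p := 2) (by norm_num) (B (J (e k)))
    simp only [ENNReal.toReal_ofNat, Real.rpow_ofNat, Real.norm_eq_abs, sq_abs] at h
    exact h
  refine le_of_tendsto' hsum.tendsto_sum_nat fun N => (Finset.sum_le_sum fun j _ => ?_).trans
    (sum_tail_le M N hM)
  have hm : ∀ k, moment (J (e k)) j = -(inner ℝ (e k) (mono (j + 1)) / (j + 1)) := by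
    intro k
    have h0 : inner ℝ (mono 0) (e k) = 0 := hw k ⟨0, hM⟩
    rw [moment_J, h0, real_inner_comm]
    ring
  simp only [hm, neg_sq, div_pow]
  split_ifs with hlt
  · refine (Finset.sum_eq_zero fun k _ => ?_).le
    have h0 : inner ℝ (mono (j + 1)) (e k) = 0 := hw k ⟨j + 1, hlt⟩
    rw [real_inner_comm, h0]
    simp
  · have hb := he.sum_inner_products_le (mono (j + 1)) (s := Finset.univ)
    simp only [Real.norm_eq_abs, sq_abs] at hb
    rw [← real_inner_self_eq_norm_sq, inner_mono] at hb
    rw [← Finset.sum_div, div_le_iff₀ (by positivity)]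
    refine hb.trans (le_of_eq ?_)
    push_cast
    field_simp
    ring

theorem singularValue_B_comp_J_le {i : ℕ} (hi : 1 ≤ i) :
    singularValue (B ∘L J) i ≤ (‖B ∘L J‖ + 5) / (i : ℝ) ^ (3 / 2 : ℝ) := by
  have hi0 : (0 : ℝ) < i := by exact_mod_cast hi
  refine singularValue_le _ (by positivity) fun s hs h => ?_
  -- For `i = 1` the choice `M = i / 2` would be `0`; the summand `‖B ∘L J‖` in the constant covers
  -- this case.
  rcases hi.eq_or_lt with rfl | hi2
  · simpa using (le_opNorm_of_le_rank_eigenspaceGE _ le_rfl h).trans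
      (le_add_of_nonneg_right (by norm_num : (0 : ℝ) ≤ 5))
  -- From `i ≤ 2 (i - M)` and `i ≤ 3 M` (sharp at `i = 3`) follows `i ^ 3 * s ^ 2 ≤ 18 ≤ 5 ^ 2`.
  have h1 := (tailBound_B_comp_J (i / 2) (by omega)).mul_sq_le h
  have h2 : (i : ℝ) ≤ 2 * ((i - i / 2 : ℕ) : ℝ) := by exact_mod_cast (by omega)
  have h3 : (i : ℝ) ≤ 3 * ((i / 2 : ℕ) : ℝ) := by exact_mod_cast (by omega)
  have h4 : (0 : ℝ) < ((i / 2 : ℕ) : ℝ) := by linarith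
  rw [le_div_iff₀ (by positivity)] at h1
  rw [le_div_iff₀ (by positivity)]
  refine le_trans (le_of_sq_le_sq ?_ (by norm_num)) (le_add_of_nonneg_left (norm_nonneg _))
  have h5 : ((i : ℝ) ^ (3 / 2 : ℝ)) ^ 2 = (i : ℝ) * (i : ℝ) ^ 2 := by
    rw [← Real.rpow_natCast, ← Real.rpow_mul hi0.le, ← pow_succ']
    norm_num
  rw [mul_pow, h5]
  have h6 : (i : ℝ) * (i : ℝ) ^ 2 ≤
      (2 * ((i - i / 2 : ℕ) : ℝ)) * (3 * ((i / 2 : ℕ) : ℝ)) ^ 2 := by gcongr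
  nlinarith [mul_le_mul_of_nonneg_left h6 (sq_nonneg s)]

end HausdorffMoment

end

theorem theorem5p1 :
    IsCompactOperator HausdorffMoment.J ∧ ¬ IsCompactOperator HausdorffMoment.B ∧
    IsCompactOperator (HausdorffMoment.B ∘L HausdorffMoment.J) ∧
    (∃ C : ℝ, 0 < C ∧ ∀ i : ℕ, 1 ≤ i →
      HausdorffMoment.singularValue (HausdorffMoment.B ∘L HausdorffMoment.J) i
        ≤ C / (i : ℝ) ^ (3 / 2 : ℝ)) ∧
    (∃ c₁ c₂ : ℝ, 0 < c₁ ∧ 0 < c₂ ∧ ∀ i : ℕ, 1 ≤ i →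
      c₁ / (i : ℝ) ≤ HausdorffMoment.singularValue HausdorffMoment.J i ∧
      HausdorffMoment.singularValue HausdorffMoment.J i ≤ c₂ / (i : ℝ)) ∧
    (∃ K : ℝ, 0 < K ∧ ∀ i : ℕ, 1 ≤ i →
      HausdorffMoment.singularValue (HausdorffMoment.B ∘L HausdorffMoment.J) i /
        HausdorffMoment.singularValue HausdorffMoment.J i ≤ K / (i : ℝ) ^ (1 / 2 : ℝ)) := by
  have hC : 0 < ‖HausdorffMoment.B ∘L HausdorffMoment.J‖ + 5 := by positivity
  refine ⟨HausdorffMoment.isCompactOperator_J, HausdorffMoment.not_isCompactOperator_B,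
    HausdorffMoment.isCompactOperator_J.clm_comp HausdorffMoment.B,
    ⟨_, hC, fun i hi => HausdorffMoment.singularValue_B_comp_J_le hi⟩,
    ⟨1 / Real.pi, 2, by positivity, two_pos, fun i hi =>
      ⟨HausdorffMoment.le_singularValue_J hi, HausdorffMoment.singularValue_J_le hi⟩⟩,
    -- The upper constant for `B ∘L J` divided by the lower constant `1 / π` for `J`.
    ⟨(‖HausdorffMoment.B ∘L HausdorffMoment.J‖ + 5) * Real.pi, by positivity, fun i hi => ?_⟩⟩
  have hi0 : (0 : ℝ) < i := by exact_mod_cast hi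
  refine (div_le_div₀ (by positivity) (HausdorffMoment.singularValue_B_comp_J_le hi)
    (by positivity) (HausdorffMoment.le_singularValue_J hi)).trans (le_of_eq ?_)
  have h : (i : ℝ) ^ (3 / 2 : ℝ) = (i : ℝ) ^ (1 / 2 : ℝ) * i := by
    rw [← Real.rpow_add_one hi0.ne']
    norm_num
  rw [h]
  field_simp
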